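/- Let $p$ be a prime, let $u \ge 0$ be an integer, and let $G$ be a finite abelian $p$-group. For each $n \ge 0$ let $M$ be a random $(n+u)\times n$ matrix over $\mathbb{Z}_p$, distributed according to the additive Haar measure on the group of all such matrices, normalized to have total mass $1$, and let $\operatorname{coker} M = \mathbb{Z}_p^{\,n+u} / M\,\mathbb{Z}_p^{\,n}$. Then $$\lim_{n\to\infty} \mathbb{P}\bigl(\operatorname{coker} M \cong \mathbb{Z}_p^{\,u} \oplus G\bigr) = \frac{\prod_{i=1}^{\infty}\bigl(1-p^{-i-u}\bigr)}{|G|^u\,|\operatorname{Aut} G|}.$$ (The event is a Borel set for every $n$, and the infinite product converges unconditionally.) -/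

import Mathlib

open Filter Topology MeasureTheory

noncomputable section

namespace RandomCokernel

/-- The space of `m × n` matrices over `ℤ_p` (with the product topology) carries its Borel
`σ`-algebra. -/
instance instMeasurableSpaceMatrix (p : ℕ) [Fact p.Prime] (m n : ℕ) :
    MeasurableSpace (Matrix (Fin m) (Fin n) ℤ_[p]) :=
  borel _

instance instBorelSpaceMatrix (p : ℕ) [Fact p.Prime] (m n : ℕ) :
    BorelSpace (Matrix (Fin m) (Fin n) ℤ_[p]) :=
  ⟨rfl⟩

instance instCompactSpaceMatrix (p : ℕ) [Fact p.Prime] (m n : ℕ) :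
    CompactSpace (Matrix (Fin m) (Fin n) ℤ_[p]) :=
  inferInstanceAs (CompactSpace (Fin m → Fin n → ℤ_[p]))

/-- The Haar measure on the additive group of `m × n` matrices over `ℤ_p`, normalized so that the
whole (compact) group has measure `1`. -/
def haarMatrix (p : ℕ) [Fact p.Prime] (m n : ℕ) : Measure (Matrix (Fin m) (Fin n) ℤ_[p]) :=
  Measure.addHaarMeasure ⊤

instance instIsAddHaarMeasureHaarMatrix (p : ℕ) [Fact p.Prime] (m n : ℕ) :
    (haarMatrix p m n).IsAddHaarMeasure :=
  inferInstanceAs (Measure.addHaarMeasure _).IsAddHaarMeasure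

instance instIsProbabilityMeasureHaarMatrix (p : ℕ) [Fact p.Prime] (m n : ℕ) :
    IsProbabilityMeasure (haarMatrix p m n) :=
  ⟨Measure.addHaarMeasure_self⟩

/-- The cokernel `ℤ_p^m / M ℤ_p^n` of an `m × n` matrix `M`, seen as a map `ℤ_p^n → ℤ_p^m`. -/
abbrev Coker {p : ℕ} [Fact p.Prime] {m n : ℕ} (M : Matrix (Fin m) (Fin n) ℤ_[p]) : Type :=
  (Fin m → ℤ_[p]) ⧸ LinearMap.range M.mulVecLin

/-- The event `coker M ≅ ℤ_p^u ⊕ G`. The isomorphism is one of abelian groups; between finitely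
generated `ℤ_p`-modules these are the same as isomorphisms of `ℤ_p`-modules. -/
def cokerEvent (p : ℕ) [Fact p.Prime] (u n : ℕ) (G : Type*) [AddCommGroup G] :
    Set (Matrix (Fin (n + u)) (Fin n) ℤ_[p]) :=
  {M | Nonempty (Coker M ≃+ (Fin u → ℤ_[p]) × G)}

end RandomCokernel

end

/-! The event is transposed first. By Smith normal form, `coker M ≅ ℤ_p^u ⊕ G` exactly when the rows
of `M` span a submodule `K ⊆ ℤ_p^n` with `ℤ_p^n / K ≅ G` (`nonempty_coker_equiv_iff`). So the event
is a finite disjoint union, over such `K`, of the events "the row span is `K`".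

For fixed `K`, all `n + u` rows lie in `K` with probability `|G|^{-(n+u)}`. Given this, they are
independent and uniform in `K ≅ ℤ_p^n`, and by Nakayama they generate `K` iff their reductions span
`𝔽_p^n`, which has probability `∏_{i=1}^n (1 - p^{-i-u})` (`measureReal_span_row_eq`).

A submodule `K` is a surjection `ℤ_p^n → G` up to `Aut G`, so there are `#Sur(ℤ_p^n, G) / |Aut G|`
of them. This gives an exact formula for each `n` (`measureReal_cokerEvent`). The limit follows
because `#Sur(ℤ_p^n, G) / |G|^n → 1` (`tendsto_card_surjective_div`). -/

/-! ### Smith normal form: a matrix and its transpose -/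

section SmithForm

variable {R : Type*} [CommRing R]

/-- Pairing with the vectors of a basis is a linear automorphism of coordinate space. -/
noncomputable def Module.Basis.pairingEquiv {ι : Type*} [Fintype ι] [DecidableEq ι]
    (b : Module.Basis ι R (ι → R)) : (ι → R) ≃ₗ[R] (ι → R) :=
  _root_.dotProductEquiv R ι ≪≫ₗ (b.constr R).symm

theorem Module.Basis.pairingEquiv_apply {ι : Type*} [Fintype ι] [DecidableEq ι]
    (b : Module.Basis ι R (ι → R)) (x : ι → R) (i : ι) :
    b.pairingEquiv x i = x ⬝ᵥ b i := by
  simp [Module.Basis.pairingEquiv, Module.Basis.constr]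

/-- Splits the coordinates of a Smith basis into the `n` that carry invariant factors and the `u`
free ones. -/
theorem exists_equiv_sum_extending {n u : ℕ} (f : Fin n ↪ Fin (n + u)) :
    ∃ e : Fin n ⊕ Fin u ≃ Fin (n + u), ∀ i, e (Sum.inl i) = f i := by
  classical
  have hc : Fintype.card ((Set.range f)ᶜ : Set (Fin (n + u))) = Fintype.card (Fin u) := by
    rw [Fintype.card_compl_set, Set.card_range_of_injective f.injective]
    simp
  refine ⟨(Equiv.sumCongr (Equiv.ofInjective f f.injective) (Fintype.equivOfCardEq hc.symm)).trans
    (Equiv.Set.sumCompl _), fun i => ?_⟩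
  simp

/-- An injective matrix has the same invariant factors as its transpose. -/
theorem exists_invariantFactors [IsDomain R] [IsPrincipalIdealRing R] {n u : ℕ}
    (M : Matrix (Fin (n + u)) (Fin n) R) (hM : Function.Injective M.mulVecLin) :
    ∃ a : Fin n → R, (∀ i, a i ≠ 0) ∧
      Nonempty (((Fin n → R) ⧸ Submodule.span R (Set.range M.row)) ≃ₗ[R]
        ((Fin n → R) ⧸ Submodule.pi Set.univ fun i => Ideal.span {a i})) ∧
      Nonempty (((Fin (n + u) → R) ⧸ LinearMap.range M.mulVecLin) ≃ₗ[R]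
        (Fin u → R) × ((Fin n → R) ⧸ Submodule.pi Set.univ fun i => Ideal.span {a i})) := by
  classical
  obtain ⟨k, S⟩ := Submodule.smithNormalForm (Pi.basisFun R (Fin (n + u)))
    (LinearMap.range M.mulVecLin)
  have hk : k = n := by
    have h1 := Module.finrank_eq_card_basis S.bN
    rw [← (LinearEquiv.ofInjective _ hM).finrank_eq] at h1
    simpa using h1.symm
  subst hk
  -- Pulling the basis of the image back along `M` gives a basis of the source. In the bases `c` and
  -- `S.bM` the matrix is diagonal.
  set c : Module.Basis (Fin k) R (Fin k → R) := S.bN.map (LinearEquiv.ofInjective _ hM).symm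
    with hc_def
  have hc : ∀ i, M.mulVec (c i) = S.a i • S.bM (S.f i) := by
    intro i
    rw [← S.snf i, ← Matrix.mulVecLin_apply,
      ← LinearEquiv.ofInjective_apply (h := hM), hc_def, Module.Basis.map_apply,
      LinearEquiv.apply_symm_apply]
  have hrow : ∀ y, y ∈ Submodule.span R (Set.range M.row) ↔ ∃ x, Matrix.vecMul x M = y := by
    intro y
    rw [← range_vecMulLinear]
    simp [LinearMap.mem_range]
  refine ⟨S.a, fun i h0 => ?_, ⟨?_⟩, ?_⟩
  · have := S.snf i
    rw [h0, zero_smul] at this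
    exact S.bN.ne_zero i (by simpa using this)
  · refine Submodule.Quotient.equiv _ _ c.pairingEquiv ?_
    ext z
    rw [Submodule.mem_map]
    simp only [Submodule.mem_pi, Set.mem_univ, true_imp_iff, Ideal.mem_span_singleton, hrow]
    constructor
    · rintro ⟨_, ⟨x, rfl⟩, rfl⟩ i
      refine ⟨x ⬝ᵥ S.bM (S.f i), ?_⟩
      rw [LinearEquiv.coe_coe, Module.Basis.pairingEquiv_apply, ← Matrix.dotProduct_mulVec, hc,
        dotProduct_smul, smul_eq_mul]
    · intro h
      choose w hw using h
      obtain ⟨e, he⟩ := exists_equiv_sum_extending S.f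
      -- Pairings with a basis can be prescribed: take `w` on the image indices and `0` on the rest.
      obtain ⟨x, hx⟩ := S.bM.pairingEquiv.surjective (fun j => Sum.elim w 0 (e.symm j))
      refine ⟨_, ⟨x, rfl⟩, ?_⟩
      ext i
      have := congrFun hx (S.f i)
      rw [Module.Basis.pairingEquiv_apply, ← he, Equiv.symm_apply_apply, Sum.elim_inl, he] at this
      rw [LinearEquiv.coe_coe, Module.Basis.pairingEquiv_apply, ← Matrix.dotProduct_mulVec, hc,
        dotProduct_smul, smul_eq_mul, this, hw]
  · obtain ⟨e, he⟩ := exists_equiv_sum_extending S.f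
    let T : (Fin (k + u) → R) →ₗ[R]
        (Fin u → R) × ((Fin k → R) ⧸ Submodule.pi Set.univ fun i => Ideal.span {S.a i}) :=
      ((LinearMap.funLeft R R (e ∘ Sum.inr)).prod
        ((Submodule.mkQ _).comp (LinearMap.funLeft R R (e ∘ Sum.inl)))).comp
        S.bM.equivFun.toLinearMap
    have hT : ∀ y, T y = (fun i => S.bM.equivFun y (e (Sum.inr i)),
        Submodule.Quotient.mk fun i => S.bM.equivFun y (e (Sum.inl i))) := fun y => rfl
    have hTs : Function.Surjective T := by
      rintro ⟨v, w⟩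
      obtain ⟨w, rfl⟩ := Submodule.mkQ_surjective _ w
      refine ⟨S.bM.equivFun.symm (fun j => Sum.elim w v (e.symm j)), ?_⟩
      rw [hT, LinearEquiv.apply_symm_apply]
      simp
    have hTk : LinearMap.ker T = LinearMap.range M.mulVecLin := by
      ext y
      have hmem : y ∈ LinearMap.ker T ↔ (∀ i, S.bM.repr y (e (Sum.inr i)) = 0) ∧
          ∀ i, S.a i ∣ S.bM.repr y (S.f i) := by
        rw [LinearMap.mem_ker, hT, Prod.mk_eq_zero, Submodule.Quotient.mk_eq_zero]
        simp only [Submodule.mem_pi, Ideal.mem_span_singleton, Set.mem_univ, true_imp_iff,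
          funext_iff, he, Module.Basis.equivFun_apply, Pi.zero_apply]
      rw [hmem]
      constructor
      · rintro ⟨h1, h2⟩
        choose w hw using h2
        refine ⟨∑ i, w i • c i, ?_⟩
        rw [map_sum]
        simp_rw [map_smul, Matrix.mulVecLin_apply, hc]
        rw [← S.bM.sum_repr y, ← e.sum_comp, Fintype.sum_sum_type]
        simp_rw [h1, he, hw]
        simp [smul_smul, mul_comm]
      · rintro ⟨x, rfl⟩
        rw [← c.sum_repr x, map_sum]
        simp_rw [map_smul, Matrix.mulVecLin_apply, hc]
        constructor
        · intro i
          have : ∀ j, S.f j ≠ e (Sum.inr i) := fun j h => by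
            rw [← he] at h; simpa using e.injective h
          simp [map_sum, Finsupp.finsetSum_apply, this]
        · intro i
          simp only [map_sum, map_smul, Module.Basis.repr_self, Finsupp.finsetSum_apply]
          refine Finset.dvd_sum fun j _ => ?_
          by_cases h : j = i
          · subst h; simp
          · simp [S.f.injective.eq_iff, h]
    exact ⟨(Submodule.quotEquivOfEq _ _ hTk.symm).trans (T.quotKerEquivOfSurjective hTs)⟩

/-- Torsion modules can be compared after adding a torsion-free module. -/
theorem nonempty_linearEquiv_of_prod_of_smul_eq_zero [IsDomain R] {F T G : Type*}
    [AddCommGroup F] [Module R F] [Module.IsTorsionFree R F] [AddCommGroup T] [Module R T]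
    [AddCommGroup G] [Module R G] {r s : R} (hr : r ≠ 0) (hT : ∀ t : T, r • t = 0)
    (hs : s ≠ 0) (hG : ∀ g : G, s • g = 0) (e : (F × T) ≃ₗ[R] (F × G)) :
    Nonempty (T ≃ₗ[R] G) := by
  -- An isomorphism sends torsion to torsion, and `F` has none.
  have h1 : ∀ t : T, (e (0, t)).1 = 0 := fun t => by
    have : r • e (0, t) = 0 := by rw [← map_smul]; simp [hT]
    have := congrArg Prod.fst this
    simpa [hr] using this
  have h2 : ∀ g : G, (e.symm (0, g)).1 = 0 := fun g => by
    have : s • e.symm (0, g) = 0 := by rw [← map_smul]; simp [hG]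
    have := congrArg Prod.fst this
    simpa [hs] using this
  refine ⟨LinearEquiv.ofLinearMap (LinearMap.snd R F G ∘ₗ e.toLinearMap ∘ₗ LinearMap.inr R F T)
    (LinearMap.snd R F T ∘ₗ e.symm.toLinearMap ∘ₗ LinearMap.inr R F G) ?_ ?_⟩
  · ext g
    have : ((0 : F), (e.symm (0, g)).2) = e.symm (0, g) := Prod.ext (h2 g).symm rfl
    simp [this]
  · ext t
    have : ((0 : F), (e (0, t)).2) = e (0, t) := Prod.ext (h1 t).symm rfl
    simp [this]

/-- For a torsion module `G`, the cokernel of a matrix is a free module of the least possible rank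
plus `G` exactly when the cokernel of the transpose is `G`. -/
theorem nonempty_coker_equiv_iff [IsDomain R] [IsPrincipalIdealRing R] {n u : ℕ} {G : Type*}
    [AddCommGroup G] [Module R G] [Module.Finite R G] {r : R} (hr : r ≠ 0) (hG : ∀ g : G, r • g = 0)
    (M : Matrix (Fin (n + u)) (Fin n) R) :
    Nonempty (((Fin (n + u) → R) ⧸ LinearMap.range M.mulVecLin) ≃ₗ[R] (Fin u → R) × G) ↔
      Nonempty (((Fin n → R) ⧸ Submodule.span R (Set.range M.row)) ≃ₗ[R] G) := by
  constructor
  · rintro ⟨e⟩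
    have hrk : Module.finrank R ((Fin u → R) × G) = u := by
      have h1 : Module.rank R (((Fin u → R) × G) ⧸ LinearMap.ker (LinearMap.fst R (Fin u → R) G))
          = Module.rank R ((Fin u → R) × G) := by
        apply rank_quotient_eq_of_le_torsion
        rintro ⟨x, g⟩ hx
        rw [LinearMap.mem_ker, LinearMap.fst_apply] at hx
        refine ⟨⟨r, mem_nonZeroDivisors_of_ne_zero hr⟩, ?_⟩
        simp_all [Submonoid.smul_def]
      have h2 := (LinearMap.quotKerEquivOfSurjective (LinearMap.fst R (Fin u → R) G)
        LinearMap.fst_surjective).finrank_eq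
      rw [Module.finrank, ← h1, ← Module.finrank, h2]
      simp
    -- The cokernel has rank `u`, so the image has rank `n` and the kernel rank `0`. A rank `0`
    -- submodule of a free module is trivial.
    have hinj : Function.Injective M.mulVecLin := by
      have h1 := Submodule.finrank_quotient_add_finrank (LinearMap.range M.mulVecLin)
      rw [e.finrank_eq, hrk] at h1
      have h2 := Submodule.finrank_quotient_add_finrank (LinearMap.ker M.mulVecLin)
      rw [M.mulVecLin.quotKerEquivRange.finrank_eq] at h2
      simp only [Module.finrank_fintype_fun_eq_card, Fintype.card_fin] at h1 h2
      rw [← LinearMap.ker_eq_bot, ← Submodule.finrank_eq_zero (R := R)]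
      omega
    obtain ⟨a, ha, ⟨e1⟩, ⟨e2⟩⟩ := exists_invariantFactors M hinj
    have ht : ∀ t : (Fin n → R) ⧸ Submodule.pi Set.univ fun i => Ideal.span {a i},
        (∏ i, a i) • t = 0 := by
      intro t
      obtain ⟨t, rfl⟩ := Submodule.mkQ_surjective _ t
      rw [← map_smul, Submodule.mkQ_apply, Submodule.Quotient.mk_eq_zero]
      simp only [Submodule.mem_pi, Set.mem_univ, true_imp_iff, Ideal.mem_span_singleton,
        Pi.smul_apply, smul_eq_mul]
      exact fun i => Dvd.dvd.mul_right (Finset.dvd_prod_of_mem a (Finset.mem_univ i)) _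
    obtain ⟨e3⟩ := nonempty_linearEquiv_of_prod_of_smul_eq_zero
      (Finset.prod_ne_zero_iff.mpr fun i _ => ha i) ht hr hG (e2.symm.trans e)
    exact ⟨e1.trans e3⟩
  · rintro ⟨e⟩
    have hinj : Function.Injective M.mulVecLin := by
      rw [← LinearMap.ker_eq_bot, Submodule.eq_bot_iff]
      intro x hx
      rw [LinearMap.mem_ker, Matrix.mulVecLin_apply] at hx
      ext j
      -- As `r` kills the quotient by the row span, `r • e_j` is a combination of rows. Pairing it
      -- with a kernel vector `x` gives `r * x j = 0`.
      have hmem : r • Pi.single j (1 : R) ∈ Submodule.span R (Set.range M.row) := by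
        rw [← Submodule.Quotient.mk_eq_zero, Submodule.Quotient.mk_smul]
        apply e.injective
        rw [map_smul, hG, map_zero]
      rw [← range_vecMulLinear] at hmem
      obtain ⟨y, hy⟩ := hmem
      have : (r • Pi.single j (1 : R)) ⬝ᵥ x = 0 := by
        rw [← hy, Matrix.vecMulLinear_apply, ← Matrix.dotProduct_mulVec, hx, dotProduct_zero]
      simpa [hr] using this
    obtain ⟨a, ha, ⟨e1⟩, ⟨e2⟩⟩ := exists_invariantFactors M hinj
    exact ⟨e2.trans (LinearEquiv.prodCongr (LinearEquiv.refl R _) (e1.symm.trans e))⟩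

end SmithForm

/-! ### Abelian groups as `ℤ_p`-modules -/

section PadicModules

variable {p : ℕ} [Fact p.Prime]

/-- Additive maps into finitely generated `ℤ_p`-modules are automatically `ℤ_p`-linear. -/
theorem AddMonoidHom.map_padicInt_smul {A B : Type*} [AddCommGroup A] [Module ℤ_[p] A]
    [AddCommGroup B] [Module ℤ_[p] B] [Module.Finite ℤ_[p] B] (f : A →+ B) (r : ℤ_[p]) (x : A) :
    f (r • x) = r • f x := by
  -- Krull's intersection theorem: it suffices that the defect of linearity lies in `p^k B` for all
  -- `k`. Approximating `r` by a natural number modulo `p^k` shows this.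
  rw [← sub_eq_zero, ← Submodule.mem_bot ℤ_[p],
    ← Ideal.iInf_pow_smul_eq_bot_of_isLocalRing (IsLocalRing.maximalIdeal ℤ_[p])
      (IsLocalRing.maximalIdeal.isMaximal _).ne_top, Submodule.mem_iInf]
  intro k
  obtain ⟨s, hs⟩ := Ideal.mem_span_singleton'.mp (PadicInt.appr_spec k r)
  have hr : r = (r.appr k : ℤ_[p]) + (p : ℤ_[p]) ^ k * s := by rw [mul_comm, hs]; ring
  have hp : ∀ z : A, f (((p : ℤ_[p]) ^ k) • z) = ((p : ℤ_[p]) ^ k) • f z := fun z => by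
    rw [← Nat.cast_pow, Nat.cast_smul_eq_nsmul, Nat.cast_smul_eq_nsmul, map_nsmul]
  have : f (r • x) - r • f x = ((p : ℤ_[p]) ^ k) • (f (s • x) - s • f x) := by
    conv_lhs => rw [hr]
    rw [add_smul, add_smul, map_add, Nat.cast_smul_eq_nsmul, Nat.cast_smul_eq_nsmul, map_nsmul,
      mul_smul, mul_smul, hp, smul_sub]
    abel
  rw [this]
  refine Submodule.smul_mem_smul (Ideal.pow_mem_pow ?_ k) trivial
  rw [PadicInt.maximalIdeal_eq_span_p]
  exact Ideal.mem_span_singleton_self _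

theorem nonempty_addEquiv_iff_nonempty_linearEquiv_padicInt {A B : Type*} [AddCommGroup A]
    [Module ℤ_[p] A] [AddCommGroup B] [Module ℤ_[p] B] [Module.Finite ℤ_[p] B] :
    Nonempty (A ≃+ B) ↔ Nonempty (A ≃ₗ[ℤ_[p]] B) :=
  ⟨fun ⟨e⟩ => ⟨e.toLinearEquiv fun r x => e.toAddMonoidHom.map_padicInt_smul r x⟩,
    fun ⟨e⟩ => ⟨e.toAddEquiv⟩⟩

/-- A finite abelian `p`-group is a `ℤ_p`-module. -/
theorem exists_padicInt_module_of_isPGroup {G : Type*} [AddCommGroup G] [Finite G]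
    (hG : IsPGroup p (Multiplicative G)) :
    ∃ k : ℕ, (∀ g : G, (p ^ k) • g = 0) ∧ Nonempty (Module ℤ_[p] G) := by
  obtain ⟨k, hk⟩ := IsPGroup.iff_card.mp hG
  have hk' : ∀ g : G, (p ^ k) • g = 0 := fun g => by
    have : Nat.card G = p ^ k := hk
    rw [← this]
    exact card_nsmul_eq_zero'
  let _ : Module (ZMod (p ^ k)) G := AddCommGroup.zmodModule hk'
  exact ⟨k, hk', ⟨Module.compHom G (PadicInt.toZModPow (p := p) k)⟩⟩

theorem card_linearEquiv_eq_card_addAut {G : Type*} [AddCommGroup G] [Module ℤ_[p] G] [Finite G] :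
    Nat.card (G ≃ₗ[ℤ_[p]] G) = Nat.card (AddAut G) :=
  Nat.card_congr
    { toFun := fun e => e.toAddEquiv
      invFun := fun e => e.toLinearEquiv fun r x => e.toAddMonoidHom.map_padicInt_smul r x
      left_inv := fun _ => rfl
      right_inv := fun _ => rfl }

end PadicModules

/-! ### Counting submodules by surjections -/

section Surjections

variable {R : Type*} [Ring R] {A G : Type*} [AddCommGroup A] [Module R A] [AddCommGroup G]
  [Module R G]

/-- A surjection onto `G` is a kernel together with an automorphism of `G`. -/
theorem card_surjective_eq_card_submodule_mul_card_linearEquiv :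
    Nat.card {f : A →ₗ[R] G // Function.Surjective f} =
      Nat.card {K : Submodule R A // Nonempty ((A ⧸ K) ≃ₗ[R] G)} * Nat.card (G ≃ₗ[R] G) := by
  rw [← Nat.card_prod]
  refine (Nat.card_congr (Equiv.ofBijective
    (fun x : {K : Submodule R A // Nonempty ((A ⧸ K) ≃ₗ[R] G)} × (G ≃ₗ[R] G) =>
      (⟨x.2.toLinearMap ∘ₗ x.1.2.some.toLinearMap ∘ₗ x.1.1.mkQ,
        x.2.surjective.comp (x.1.2.some.surjective.comp x.1.1.mkQ_surjective)⟩ :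
        {f : A →ₗ[R] G // Function.Surjective f})) ⟨?_, ?_⟩)).symm
  · rintro ⟨⟨K, hK⟩, α⟩ ⟨⟨K', hK'⟩, α'⟩ h
    rw [Subtype.mk.injEq] at h
    have hKK : K = K' := by
      have := congrArg LinearMap.ker h
      simpa [LinearMap.ker_comp] using this
    subst hKK
    have : α = α' := by
      ext g
      obtain ⟨x, rfl⟩ := (hK.some.surjective.comp K.mkQ_surjective) g
      exact LinearMap.congr_fun h x
    rw [this]
  · rintro ⟨f, hf⟩
    have hK : Nonempty ((A ⧸ LinearMap.ker f) ≃ₗ[R] G) := ⟨f.quotKerEquivOfSurjective hf⟩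
    refine ⟨(⟨LinearMap.ker f, hK⟩, hK.some.symm.trans (f.quotKerEquivOfSurjective hf)), ?_⟩
    ext x
    simp

theorem finite_submodule_of_finite_hom [Finite (A →ₗ[R] G)] :
    {K : Submodule R A | Nonempty ((A ⧸ K) ≃ₗ[R] G)}.Finite := by
  refine (Set.finite_range fun f : A →ₗ[R] G => LinearMap.ker f).subset ?_
  rintro K ⟨e⟩
  exact ⟨e.toLinearMap ∘ₗ K.mkQ, by simp [LinearMap.ker_comp]⟩

end Surjections

/-! ### Random tuples generate a finite module -/

section SurjectionLimit

variable {R : Type*} [CommRing R] {G : Type*} [AddCommGroup G] [Module R G] [Finite G]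

/-- Almost all long tuples of elements of a finite module generate it. -/
theorem tendsto_card_surjective_div :
    Tendsto (fun n : ℕ => (Nat.card {f : (Fin n → R) →ₗ[R] G // Function.Surjective f} : ℝ) /
      (Nat.card G : ℝ) ^ n) atTop (𝓝 1) := by
  classical
  have := Fintype.ofFinite G
  have hfin : Finite (Submodule R G) := Finite.of_injective _ SetLike.coe_injective
  have := Fintype.ofFinite (Submodule R G)
  have hpos : (0 : ℝ) < Nat.card G := by exact_mod_cast Nat.card_pos
  have key : ∀ n : ℕ, (Nat.card {f : (Fin n → R) →ₗ[R] G // Function.Surjective f} : ℝ) /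
      (Nat.card G : ℝ) ^ n ∈ Set.Icc (1 - (Fintype.card (Submodule R G) : ℝ) * (1 / 2) ^ n) 1 := by
    intro n
    have e : {f : (Fin n → R) →ₗ[R] G // Function.Surjective f} ≃
        {t : Fin n → G // Submodule.span R (Set.range t) = ⊤} :=
      (((Pi.basisFun R (Fin n)).constr R).toEquiv.subtypeEquiv fun t => by
        rw [← LinearMap.range_eq_top, LinearEquiv.coe_toEquiv, Module.Basis.constr_range]).symm
    rw [Nat.card_congr e, Nat.card_eq_fintype_card, Fintype.card_subtype]
    have hle : (Finset.univ.filter fun t : Fin n → G => Submodule.span R (Set.range t) = ⊤).card ≤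
        Nat.card G ^ n := by
      refine (Finset.card_le_univ _).trans_eq ?_
      simp
    -- A tuple that does not generate lies in a proper submodule. Each of these has index at least
    -- `2`, so it contains at most `(|G| / 2) ^ n` tuples.
    have hsub : (Finset.univ : Finset (Fin n → G)) ⊆
        (Finset.univ.filter fun t : Fin n → G => Submodule.span R (Set.range t) = ⊤) ∪
        (Finset.univ.filter fun H : Submodule R G => H ≠ ⊤).biUnion
          fun H => Fintype.piFinset fun _ => Finset.univ.filter (· ∈ H) := by
      intro t _
      by_cases h : Submodule.span R (Set.range t) = ⊤
      · simp [h]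
      · simp only [Finset.mem_union, Finset.mem_filter, Finset.mem_univ, true_and,
          Finset.mem_biUnion, Fintype.mem_piFinset]
        exact Or.inr ⟨_, h, fun i => Submodule.subset_span ⟨i, rfl⟩⟩
    have h1 := (Finset.card_le_card hsub).trans
      ((Finset.card_union_le _ _).trans (Nat.add_le_add_left Finset.card_biUnion_le _))
    have h2 : ∀ H ∈ (Finset.univ.filter fun H : Submodule R G => H ≠ ⊤),
        ((Fintype.piFinset fun _ : Fin n => Finset.univ.filter (· ∈ H)).card : ℝ) ≤
          (Nat.card G : ℝ) ^ n * (1 / 2) ^ n := by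
      intro H hH
      rw [Fintype.card_piFinset_const, ← mul_pow]
      push_cast
      refine pow_le_pow_left₀ (by positivity) ?_ n
      have hcard : (Finset.univ.filter (· ∈ H)).card = Nat.card H := by
        rw [Nat.card_eq_fintype_card, Fintype.card_subtype]
      have hidx := H.toAddSubgroup.card_mul_index
      have hne : H.toAddSubgroup.index ≠ 1 := by
        rw [Ne, AddSubgroup.index_eq_one]
        intro h
        exact (Finset.mem_filter.mp hH).2 (by simpa using h)
      have hne0 : H.toAddSubgroup.index ≠ 0 := AddSubgroup.index_ne_zero_of_finite
      have h3 : Nat.card H * 2 ≤ Nat.card G := by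
        rw [← hidx]
        exact Nat.mul_le_mul_left _ (by omega)
      rw [hcard]
      have h4 : (Nat.card H : ℝ) * 2 ≤ Nat.card G := by exact_mod_cast h3
      linarith
    have h3 : (Nat.card G : ℝ) ^ n ≤
        ((Finset.univ.filter fun t : Fin n → G => Submodule.span R (Set.range t) = ⊤).card : ℝ) +
        Fintype.card (Submodule R G) * ((Nat.card G : ℝ) ^ n * (1 / 2) ^ n) := by
      have h5 : Nat.card G ^ n = (Finset.univ : Finset (Fin n → G)).card := by simp
      rw [← Nat.cast_pow, h5]
      refine (Nat.cast_le.mpr h1).trans ?_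
      push_cast
      gcongr
      refine (Finset.sum_le_sum h2).trans ?_
      rw [Finset.sum_const, nsmul_eq_mul, ← h5]
      push_cast
      gcongr
      exact Finset.card_le_univ _
    constructor
    · rw [le_div_iff₀ (by positivity)]
      linarith
    · rw [div_le_one (by positivity)]
      exact_mod_cast hle
  refine tendsto_of_tendsto_of_tendsto_of_le_of_le ?_ tendsto_const_nhds (fun n => (key n).1)
    fun n => (key n).2
  have := (tendsto_pow_atTop_nhds_zero_of_lt_one (r := (1 / 2 : ℝ)) (by norm_num)
    (by norm_num)).const_mul (Fintype.card (Submodule R G) : ℝ)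
  simpa using this.const_sub 1

end SurjectionLimit

/-! ### Invariant measure on finite quotients -/

section FiniteQuotients

variable {Γ : Type*} [AddCommGroup Γ] [MeasurableSpace Γ] [MeasurableAdd Γ] (μ : Measure Γ)
  [IsProbabilityMeasure μ] [μ.IsAddLeftInvariant]

/-- A homomorphism onto a finite group pushes an invariant measure to a uniform one. -/
theorem MeasureTheory.measureReal_preimage_of_surjective (H : AddSubgroup Γ) {A : Type*}
    [AddCommGroup A] [Finite A] (f : H →+ A) (hf : Function.Surjective f)
    (hm : MeasurableSet ((f.ker.map H.subtype : AddSubgroup Γ) : Set Γ)) (S : Set A) :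
    MeasurableSet {x | ∃ h : x ∈ H, f ⟨x, h⟩ ∈ S} ∧
      μ.real {x | ∃ h : x ∈ H, f ⟨x, h⟩ ∈ S} * Nat.card A = Nat.card S * μ.real (H : Set Γ) := by
  classical
  have := Fintype.ofFinite A
  set N : Set Γ := ((f.ker.map H.subtype : AddSubgroup Γ) : Set Γ) with hN
  have hmemN : ∀ x, x ∈ N ↔ ∃ h : x ∈ H, f ⟨x, h⟩ = 0 := fun x => by
    simp [hN, AddMonoidHom.mem_ker]
  let F : A → Set Γ := fun a => {x | ∃ h : x ∈ H, f ⟨x, h⟩ = a}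
  -- Every fibre of `f` is a translate of its kernel, so all fibres have equal measure.
  have hF : ∀ a, ∃ y : Γ, F a = (fun x => y + x) ⁻¹' N := by
    intro a
    obtain ⟨⟨y, hy⟩, rfl⟩ := hf a
    refine ⟨-y, ?_⟩
    ext x
    simp only [F, Set.mem_preimage, hmemN, Set.mem_ofPred_eq]
    constructor
    · rintro ⟨h, hx⟩
      refine ⟨H.add_mem (H.neg_mem hy) h, ?_⟩
      have : (⟨-y + x, H.add_mem (H.neg_mem hy) h⟩ : H) = -⟨y, hy⟩ + ⟨x, h⟩ := rfl
      rw [this, map_add, map_neg, hx, neg_add_cancel]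
    · rintro ⟨h, hx⟩
      have hxH : x ∈ H := by simpa using H.add_mem hy h
      refine ⟨hxH, ?_⟩
      have : (⟨-y + x, h⟩ : H) = -⟨y, hy⟩ + ⟨x, hxH⟩ := rfl
      rw [this, map_add, map_neg, neg_add_eq_zero] at hx
      exact hx.symm
  have hFm : ∀ a, MeasurableSet (F a) := fun a => by
    obtain ⟨y, hy⟩ := hF a
    rw [hy]
    exact measurable_const_add y hm
  have hFμ : ∀ a, μ.real (F a) = μ.real N := fun a => by
    obtain ⟨y, hy⟩ := hF a
    rw [hy, measureReal_def, measure_preimage_add, measureReal_def]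
  have hU : ∀ T : Finset A, {x | ∃ h : x ∈ H, f ⟨x, h⟩ ∈ T} = ⋃ a ∈ T, F a := fun T => by
    ext x
    simp [F]
  have hμ : ∀ T : Finset A, μ.real {x | ∃ h : x ∈ H, f ⟨x, h⟩ ∈ T} = T.card * μ.real N := by
    intro T
    rw [hU, measureReal_biUnion_finset]
    · simp [hFμ]
    · intro a _ b _ hab
      refine Set.disjoint_left.mpr ?_
      rintro x ⟨h, rfl⟩ ⟨_, h'⟩
      exact hab h'
    · exact fun a _ => hFm a
  have hS : {x | ∃ h : x ∈ H, f ⟨x, h⟩ ∈ S} = {x | ∃ h : x ∈ H, f ⟨x, h⟩ ∈ S.toFinset} := by simp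
  have hH : (H : Set Γ) = {x | ∃ h : x ∈ H, f ⟨x, h⟩ ∈ (Finset.univ : Finset A)} := by
    ext x; simp
  constructor
  · rw [hS, hU]
    exact Finset.measurableSet_biUnion _ fun a _ => hFm a
  · rw [hS, hH, hμ, hμ, Nat.card_eq_fintype_card, Nat.card_eq_fintype_card, Set.toFinset_card,
      Finset.card_univ]
    ring

end FiniteQuotients

/-! ### Generation modulo `p` -/

section Nakayama

variable {p : ℕ} [Fact p.Prime] {m n : ℕ}

/-- Vectors over `ℤ_p` generate exactly when their reductions modulo `p` do. -/
theorem span_eq_top_iff_span_toZMod_eq_top (w : Fin m → Fin n → ℤ_[p]) :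
    Submodule.span ℤ_[p] (Set.range w) = ⊤ ↔
      Submodule.span (ZMod p) (Set.range fun i j => PadicInt.toZMod (w i j)) = ⊤ := by
  have : RingHomSurjective (PadicInt.toZMod (p := p)) := ⟨ZMod.ringHom_surjective _⟩
  let π : (Fin n → ℤ_[p]) →ₛₗ[PadicInt.toZMod (p := p)] (Fin n → ZMod p) :=
    { toFun := fun x j => PadicInt.toZMod (x j)
      map_add' := fun x y => by ext; simp
      map_smul' := fun r x => by ext; simp }
  have hπ : Function.Surjective π := fun y => by
    choose x hx using fun j => ZMod.ringHom_surjective (PadicInt.toZMod (p := p)) (y j)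
    exact ⟨x, funext hx⟩
  have hspan : Submodule.span (ZMod p) (Set.range fun i j => PadicInt.toZMod (w i j)) =
      (Submodule.span ℤ_[p] (Set.range w)).map π := by
    rw [Submodule.map_span, ← Set.range_comp]
    rfl
  rw [hspan]
  constructor
  · intro h
    rw [h, Submodule.map_top, LinearMap.range_eq_top.mpr hπ]
  · intro h
    rw [eq_top_iff]
    refine Submodule.le_of_le_smul_of_le_jacobson_bot (I := IsLocalRing.maximalIdeal ℤ_[p])
      Module.Finite.fg_top (IsLocalRing.maximalIdeal_le_jacobson _) fun x _ => ?_
    obtain ⟨y, hy, hxy⟩ : π x ∈ (Submodule.span ℤ_[p] (Set.range w)).map π := h ▸ trivial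
    rw [← add_sub_cancel y x]
    refine Submodule.add_mem_sup hy ?_
    rw [← Finset.univ_sum_single (x - y)]
    refine Submodule.sum_mem _ fun j _ => ?_
    rw [← mul_one ((x - y) j), ← smul_eq_mul, Pi.single_smul]
    refine Submodule.smul_mem_smul ?_ trivial
    rw [← PadicInt.ker_toZMod, RingHom.mem_ker, Pi.sub_apply, map_sub, sub_eq_zero]
    exact (congrFun hxy j).symm

/-- The number of `(n + u)`-tuples generating an `n`-dimensional space over a finite field. -/
theorem card_span_eq_top (F : Type*) [Field F] [Fintype F] (n u : ℕ) :
    Nat.card {t : Fin (n + u) → Fin n → F | Submodule.span F (Set.range t) = ⊤} =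
      ∏ i : Fin n, (Fintype.card F ^ (n + u) - Fintype.card F ^ i.val) := by
  have h := card_linearIndependent (K := F) (V := Fin (n + u) → F) (k := n) (by simp)
  rw [Module.finrank_fin_fun] at h
  rw [← h]
  -- Row rank equals column rank: `n + u` vectors span `F^n` iff the `n` vectors of the transpose
  -- are linearly independent.
  refine Nat.card_congr ((Equiv.piComm fun _ _ => F).subtypeEquiv fun t => ?_)
  have h1 := Matrix.rank_transpose (Matrix.of t)
  rw [Matrix.rank_eq_finrank_span_row, Matrix.rank_eq_finrank_span_row] at h1
  rw [linearIndependent_iff_card_eq_finrank_span, Fintype.card_fin, Set.finrank]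
  change Submodule.span F (Set.range t) = ⊤ ↔
    n = Module.finrank F (Submodule.span F (Set.range (Matrix.of t).transpose.row))
  rw [h1]
  change Submodule.span F (Set.range t) = ⊤ ↔
    n = Module.finrank F (Submodule.span F (Set.range t))
  constructor
  · intro h
    rw [h, finrank_top, Module.finrank_fin_fun]
  · intro h
    refine Submodule.eq_top_of_finrank_eq ?_
    rw [← h, Module.finrank_fin_fun]

end Nakayama

/-! ### The law of the row span -/

namespace RandomCokernel

variable {p : ℕ} [Fact p.Prime] {m n : ℕ}

/-- The matrices whose rows lie in a given submodule. -/
def rowsIn (m : ℕ) (K : Submodule ℤ_[p] (Fin n → ℤ_[p])) :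
    AddSubgroup (Matrix (Fin m) (Fin n) ℤ_[p]) where
  carrier := {M | ∀ i, M.row i ∈ K}
  zero_mem' := fun _ => K.zero_mem
  add_mem' := fun hM hN i => K.add_mem (hM i) (hN i)
  neg_mem' := fun hM i => K.neg_mem (hM i)

/-- A subgroup of matrices containing all multiples of a power of `p` is open. -/
theorem isOpen_of_forall_pow_smul_mem (N : AddSubgroup (Matrix (Fin m) (Fin n) ℤ_[p])) (k : ℕ)
    (hN : ∀ M : Matrix (Fin m) (Fin n) ℤ_[p], (p : ℤ_[p]) ^ k • M ∈ N) :
    IsOpen (N : Set (Matrix (Fin m) (Fin n) ℤ_[p])) := by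
  refine N.isOpen_of_mem_nhds (g := 0) ?_
  have hp : (0 : ℝ) < (p : ℝ) ^ (-k : ℤ) := by
    have : (0 : ℝ) < p := by exact_mod_cast (Fact.out : p.Prime).pos
    positivity
  have h : ∀ᶠ M in 𝓝 (0 : Matrix (Fin m) (Fin n) ℤ_[p]), ∀ i j, ‖M i j‖ < (p : ℝ) ^ (-k : ℤ) := by
    refine eventually_all.mpr fun i => eventually_all.mpr fun j => ?_
    have hc : Continuous fun M : Matrix (Fin m) (Fin n) ℤ_[p] => ‖M i j‖ := by fun_prop
    exact hc.continuousAt.eventually_lt_const (by simpa using hp)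
  filter_upwards [h] with M hM
  have hd : ∀ i j, ∃ c, M i j = (p : ℤ_[p]) ^ k * c := fun i j =>
    Ideal.mem_span_singleton.mp ((PadicInt.norm_le_pow_iff_mem_span_pow _ k).mp (hM i j).le)
  choose c hc using hd
  have : M = (p : ℤ_[p]) ^ k • Matrix.of c := by
    ext i j
    rw [hc, Matrix.smul_apply, Matrix.of_apply, smul_eq_mul]
  rw [this]
  exact hN _

variable {k : ℕ} {K : Submodule ℤ_[p] (Fin n → ℤ_[p])}

/-- Reducing each row modulo `K` maps the matrices onto `(ℤ_p^n / K)^m` with kernel `rowsIn m K`. -/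
theorem measureReal_rowsIn [Finite ((Fin n → ℤ_[p]) ⧸ K)]
    (hK : ∀ x, (p : ℤ_[p]) ^ k • x ∈ K) :
    (haarMatrix p m n).real (rowsIn m K) = ((Nat.card ((Fin n → ℤ_[p]) ⧸ K) : ℝ) ^ m)⁻¹ := by
  let f : (⊤ : AddSubgroup (Matrix (Fin m) (Fin n) ℤ_[p])) →+ (Fin m → ((Fin n → ℤ_[p]) ⧸ K)) :=
    { toFun := fun M i => K.mkQ (M.1.row i)
      map_zero' := by ext i; exact map_zero K.mkQ
      map_add' := fun M N => by ext i; exact map_add K.mkQ _ _ }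
  have hf : Function.Surjective f := fun y => by
    choose x hx using fun i => K.mkQ_surjective (y i)
    exact ⟨⟨Matrix.of x, trivial⟩, funext hx⟩
  have hker : f.ker.map (AddSubgroup.subtype _) = rowsIn m K := by
    ext M
    simp only [AddSubgroup.mem_map, AddMonoidHom.mem_ker, AddSubgroup.coe_subtype]
    constructor
    · rintro ⟨M, hM, rfl⟩ i
      exact (Submodule.Quotient.mk_eq_zero K).mp (congrFun hM i)
    · intro hM
      exact ⟨⟨M, trivial⟩, funext fun i => (Submodule.Quotient.mk_eq_zero K).mpr (hM i), rfl⟩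
  have hm : MeasurableSet ((f.ker.map (AddSubgroup.subtype _) : AddSubgroup _) :
      Set (Matrix (Fin m) (Fin n) ℤ_[p])) := by
    rw [hker]
    exact (isOpen_of_forall_pow_smul_mem (rowsIn m K) k fun M i => hK (M.row i)).measurableSet
  have h := (measureReal_preimage_of_surjective (haarMatrix p m n) ⊤ f hf hm {0}).2
  have hset : {x | ∃ h : x ∈ (⊤ : AddSubgroup (Matrix (Fin m) (Fin n) ℤ_[p])),
      f ⟨x, h⟩ ∈ ({0} : Set (Fin m → ((Fin n → ℤ_[p]) ⧸ K)))} = rowsIn m K := by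
    rw [← hker]
    ext x
    simp [AddMonoidHom.mem_ker]
  rw [hset] at h
  refine eq_inv_of_mul_eq_one_left ?_
  simpa [Nat.card_fun] using h

/-- Multiplication by `p ^ k` embeds `ℤ_p^n` in `K`, so `K` has full rank. -/
theorem nonempty_basis_of_forall_pow_smul_mem (hK : ∀ x, (p : ℤ_[p]) ^ k • x ∈ K) :
    Nonempty (Module.Basis (Fin n) ℤ_[p] K) := by
  have hp : (p : ℤ_[p]) ^ k ≠ 0 := pow_ne_zero _ (by exact_mod_cast (Fact.out : p.Prime).ne_zero)
  refine ⟨Module.finBasisOfFinrankEq _ _ (le_antisymm ?_ ?_)⟩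
  · simpa using Submodule.finrank_le K
  · have := LinearMap.finrank_le_finrank_of_injective
      (f := (LinearMap.lsmul ℤ_[p] (Fin n → ℤ_[p]) ((p : ℤ_[p]) ^ k)).codRestrict K hK) ?_
    · simpa using this
    · intro x y h
      exact smul_right_injective _ hp (congrArg Subtype.val h)

theorem measureReal_span_row_eq {u : ℕ} [Finite ((Fin n → ℤ_[p]) ⧸ K)]
    (hK : ∀ x, (p : ℤ_[p]) ^ k • x ∈ K) :
    MeasurableSet {M : Matrix (Fin (n + u)) (Fin n) ℤ_[p] |
      Submodule.span ℤ_[p] (Set.range M.row) = K} ∧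
    (haarMatrix p (n + u) n).real {M | Submodule.span ℤ_[p] (Set.range M.row) = K} =
      (∏ i ∈ Finset.range n, (1 - ((p : ℝ) ^ (i + 1 + u))⁻¹)) /
        (Nat.card ((Fin n → ℤ_[p]) ⧸ K) : ℝ) ^ (n + u) := by
  obtain ⟨b⟩ := nonempty_basis_of_forall_pow_smul_mem hK
  -- Coordinates of the rows in the basis of `K`, reduced modulo `p`. Whether the rows generate `K`
  -- depends only on this finite quotient.
  let f : rowsIn (n + u) K →+ (Fin (n + u) → Fin n → ZMod p) :=
    { toFun := fun M i j => PadicInt.toZMod (b.equivFun ⟨M.1.row i, M.2 i⟩ j)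
      map_zero' := by
        ext i j
        have : (⟨(0 : rowsIn (n + u) K).1.row i, (0 : rowsIn (n + u) K).2 i⟩ : K) = 0 := rfl
        rw [this, map_zero]
        simp
      map_add' := fun M N => by
        ext i j
        have : (⟨(M + N).1.row i, (M + N).2 i⟩ : K) =
          ⟨M.1.row i, M.2 i⟩ + ⟨N.1.row i, N.2 i⟩ := rfl
        rw [this, map_add]
        simp }
  have hf : Function.Surjective f := fun y => by
    choose x hx using fun i j => ZMod.ringHom_surjective (PadicInt.toZMod (p := p)) (y i j)
    refine ⟨⟨Matrix.of fun i => (b.equivFun.symm (x i) : K), fun i =>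
      (b.equivFun.symm (x i)).2⟩, ?_⟩
    ext i j
    have : (⟨(Matrix.of fun i => ((b.equivFun.symm (x i) : K) : Fin n → ℤ_[p])).row i,
      (b.equivFun.symm (x i)).2⟩ : K) = b.equivFun.symm (x i) := rfl
    change PadicInt.toZMod (b.equivFun _ j) = _
    rw [this, LinearEquiv.apply_symm_apply, hx]
  have hm : MeasurableSet ((f.ker.map (AddSubgroup.subtype _) : AddSubgroup _) :
      Set (Matrix (Fin (n + u)) (Fin n) ℤ_[p])) := by
    -- `p ^ k` brings the rows into `K`; one more factor `p` makes their coordinates vanish modulo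
    -- `p`.
    refine (isOpen_of_forall_pow_smul_mem _ (k + 1) fun M => ?_).measurableSet
    have h1 : (p : ℤ_[p]) ^ (k + 1) • M ∈ rowsIn (n + u) K := fun i => by
      rw [pow_succ', mul_smul]
      exact K.smul_mem _ (hK (M.row i))
    refine ⟨⟨_, h1⟩, ?_, rfl⟩
    change f _ = 0
    ext i j
    have h2 : (⟨((p : ℤ_[p]) ^ (k + 1) • M).row i, h1 i⟩ : K) =
        (p : ℤ_[p]) • ⟨(p : ℤ_[p]) ^ k • M.row i, hK _⟩ := by
      ext1
      change (p : ℤ_[p]) ^ (k + 1) • M.row i = (p : ℤ_[p]) • (p : ℤ_[p]) ^ k • M.row i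
      rw [pow_succ', mul_smul]
    change PadicInt.toZMod (b.equivFun _ j) = _
    rw [h2, map_smul]
    simp
  have hset : {M : Matrix (Fin (n + u)) (Fin n) ℤ_[p] |
      Submodule.span ℤ_[p] (Set.range M.row) = K} = {M | ∃ h : M ∈ rowsIn (n + u) K,
        f ⟨M, h⟩ ∈ {t : Fin (n + u) → Fin n → ZMod p |
          Submodule.span (ZMod p) (Set.range t) = ⊤}} := by
    have key : ∀ M (h : M ∈ rowsIn (n + u) K), f ⟨M, h⟩ ∈ {t : Fin (n + u) → Fin n → ZMod p |
          Submodule.span (ZMod p) (Set.range t) = ⊤} ↔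
        Submodule.span ℤ_[p] (Set.range M.row) = K := by
      intro M h
      have h1 := span_eq_top_iff_span_toZMod_eq_top fun i => b.equivFun ⟨M.row i, h i⟩
      refine h1.symm.trans ?_
      have h2 : (Set.range fun i => b.equivFun ⟨M.row i, h i⟩) =
          b.equivFun '' Set.range fun i => (⟨M.row i, h i⟩ : K) := by
        rw [← Set.range_comp]; rfl
      have h3 : Set.range M.row = K.subtype '' Set.range fun i => (⟨M.row i, h i⟩ : K) := by
        rw [← Set.range_comp]; rfl
      rw [h2, h3, ← Submodule.map_span]
      have h4 := Submodule.map_span b.equivFun.toLinearMap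
        (Set.range fun i => (⟨M.row i, h i⟩ : K))
      have htop : ∀ L : Submodule ℤ_[p] K, L.map b.equivFun.toLinearMap = ⊤ ↔ L = ⊤ := fun L => by
        rw [← (Submodule.map_injective_of_injective (f := b.equivFun.toLinearMap)
          b.equivFun.injective).eq_iff (b := ⊤), Submodule.map_top, LinearEquiv.range]
      rw [LinearEquiv.coe_coe] at h4
      rw [← h4]
      constructor
      · intro h5
        rw [htop] at h5
        rw [h5, Submodule.map_subtype_top]
      · intro h5
        rw [htop]
        refine Submodule.map_injective_of_injective K.subtype_injective ?_
        rw [h5, Submodule.map_subtype_top]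
    ext M
    constructor
    · intro h
      have hM : M ∈ rowsIn (n + u) K := fun i => by
        rw [← (h : _ = K)]
        exact Submodule.subset_span ⟨i, rfl⟩
      exact ⟨hM, (key M hM).mpr h⟩
    · rintro ⟨h, hM⟩
      exact (key M h).mp hM
  obtain ⟨h1, h2⟩ := measureReal_preimage_of_surjective (haarMatrix p (n + u) n) _ f hf hm
    {t : Fin (n + u) → Fin n → ZMod p | Submodule.span (ZMod p) (Set.range t) = ⊤}
  rw [hset]
  refine ⟨h1, ?_⟩
  rw [measureReal_rowsIn hK, card_span_eq_top, ZMod.card] at h2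
  have hp : (0 : ℝ) < p := by exact_mod_cast (Fact.out : p.Prime).pos
  have hcard : (Nat.card (Fin (n + u) → Fin n → ZMod p) : ℝ) = ∏ i : Fin n, (p : ℝ) ^ (n + u) := by
    simp [← pow_mul, mul_comm]
  have hprod : ((∏ i : Fin n, (p ^ (n + u) - p ^ i.val) : ℕ) : ℝ) =
      (∏ i ∈ Finset.range n, (1 - ((p : ℝ) ^ (i + 1 + u))⁻¹)) * ∏ i : Fin n, (p : ℝ) ^ (n + u) := by
    -- Reversing the index matches `1 - p^{i-n-u}`, from the count of spanning tuples, with the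
    -- factor of index `n - 1 - i`.
    rw [← Finset.prod_range_reflect, ← Fin.prod_univ_eq_prod_range
      (fun i => 1 - ((p : ℝ) ^ (n - 1 - i + 1 + u))⁻¹), ← Finset.prod_mul_distrib, Nat.cast_prod]
    refine Finset.prod_congr rfl fun i _ => ?_
    have hi := i.2
    rw [Nat.cast_sub (Nat.pow_le_pow_right (Fact.out : p.Prime).pos (by omega)), sub_mul, one_mul,
      Nat.cast_pow, Nat.cast_pow]
    congr 1
    rw [eq_inv_mul_iff_mul_eq₀ (by positivity), ← pow_add]
    congr 1
    omega
  rw [hcard, hprod] at h2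
  have hne : ∏ i : Fin n, (p : ℝ) ^ (n + u) ≠ 0 := by positivity
  refine mul_right_cancel₀ hne (h2.trans ?_)
  rw [div_eq_mul_inv]
  ring

end RandomCokernel

/-! ### The exact probability and its limit -/

namespace RandomCokernel

variable {p : ℕ} [Fact p.Prime]

theorem cokerEvent_eq_iUnion {n u k : ℕ} {G : Type*} [AddCommGroup G] [Module ℤ_[p] G] [Finite G]
    (hk : ∀ g : G, (p ^ k) • g = 0) :
    cokerEvent p u n G = ⋃ K ∈ {K : Submodule ℤ_[p] (Fin n → ℤ_[p]) |
      Nonempty (((Fin n → ℤ_[p]) ⧸ K) ≃ₗ[ℤ_[p]] G)},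
      {M | Submodule.span ℤ_[p] (Set.range M.row) = K} := by
  have hp : (p : ℤ_[p]) ^ k ≠ 0 := pow_ne_zero _ (by exact_mod_cast (Fact.out : p.Prime).ne_zero)
  have hk' : ∀ g : G, (p : ℤ_[p]) ^ k • g = 0 := fun g => by
    rw [← Nat.cast_pow, Nat.cast_smul_eq_nsmul, hk]
  ext M
  have h := (nonempty_addEquiv_iff_nonempty_linearEquiv_padicInt (p := p)
    (A := Coker M) (B := (Fin u → ℤ_[p]) × G)).trans (nonempty_coker_equiv_iff hp hk' M)
  simpa [cokerEvent] using h

/-- The probability that the cokernel of a random matrix is `ℤ_p^u ⊕ G`, for a given size. -/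
theorem measureReal_cokerEvent {n u k : ℕ} {G : Type*} [AddCommGroup G] [Module ℤ_[p] G]
    [Finite G] (hk : ∀ g : G, (p ^ k) • g = 0) :
    MeasurableSet (cokerEvent p u n G) ∧
    (haarMatrix p (n + u) n).real (cokerEvent p u n G) =
      ((Nat.card {f : (Fin n → ℤ_[p]) →ₗ[ℤ_[p]] G // Function.Surjective f} : ℝ) /
        (Nat.card G : ℝ) ^ n) * (∏ i ∈ Finset.range n, (1 - ((p : ℝ) ^ (i + 1 + u))⁻¹)) /
        ((Nat.card G : ℝ) ^ u * (Nat.card (AddAut G) : ℝ)) := by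
  have : Finite ((Fin n → ℤ_[p]) →ₗ[ℤ_[p]] G) :=
    Finite.of_equiv _ ((Pi.basisFun ℤ_[p] (Fin n)).constr ℤ_[p]).toEquiv
  have hfin := finite_submodule_of_finite_hom (R := ℤ_[p]) (A := Fin n → ℤ_[p]) (G := G)
  have key : ∀ K ∈ {K : Submodule ℤ_[p] (Fin n → ℤ_[p]) |
      Nonempty (((Fin n → ℤ_[p]) ⧸ K) ≃ₗ[ℤ_[p]] G)},
      MeasurableSet {M : Matrix (Fin (n + u)) (Fin n) ℤ_[p] |
        Submodule.span ℤ_[p] (Set.range M.row) = K} ∧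
      (haarMatrix p (n + u) n).real {M | Submodule.span ℤ_[p] (Set.range M.row) = K} =
        (∏ i ∈ Finset.range n, (1 - ((p : ℝ) ^ (i + 1 + u))⁻¹)) / (Nat.card G : ℝ) ^ (n + u) := by
    rintro K ⟨e⟩
    have : Finite ((Fin n → ℤ_[p]) ⧸ K) := Finite.of_equiv _ e.symm.toEquiv
    rw [← Nat.card_congr e.toEquiv]
    refine measureReal_span_row_eq (k := k) fun x => ?_
    rw [← Submodule.Quotient.mk_eq_zero, Submodule.Quotient.mk_smul]
    apply e.injective
    rw [map_smul, map_zero, ← Nat.cast_pow, Nat.cast_smul_eq_nsmul, hk]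
  rw [cokerEvent_eq_iUnion hk]
  refine ⟨hfin.measurableSet_biUnion fun K hK => (key K hK).1, ?_⟩
  have hcount := card_surjective_eq_card_submodule_mul_card_linearEquiv (R := ℤ_[p])
    (A := Fin n → ℤ_[p]) (G := G)
  rw [card_linearEquiv_eq_card_addAut] at hcount
  have hcard : (Nat.card {K : Submodule ℤ_[p] (Fin n → ℤ_[p]) //
      Nonempty (((Fin n → ℤ_[p]) ⧸ K) ≃ₗ[ℤ_[p]] G)} : ℝ) = hfin.toFinset.card := by
    rw [← Set.ncard_eq_toFinset_card _ hfin]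
    rfl
  have hU : (⋃ K ∈ {K : Submodule ℤ_[p] (Fin n → ℤ_[p]) |
      Nonempty (((Fin n → ℤ_[p]) ⧸ K) ≃ₗ[ℤ_[p]] G)},
      {M : Matrix (Fin (n + u)) (Fin n) ℤ_[p] | Submodule.span ℤ_[p] (Set.range M.row) = K}) =
      ⋃ K ∈ hfin.toFinset, {M | Submodule.span ℤ_[p] (Set.range M.row) = K} := by
    simp
  rw [hU, measureReal_biUnion_finset]
  · rw [Finset.sum_congr rfl fun K hK => (key K (hfin.mem_toFinset.mp hK)).2, Finset.sum_const,
      nsmul_eq_mul, hcount, Nat.cast_mul, hcard]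
    have : Finite (AddAut G) := Finite.of_injective _ DFunLike.coe_injective
    have hG : (Nat.card G : ℝ) ≠ 0 := by exact_mod_cast Nat.card_pos.ne'
    have hA : (Nat.card (AddAut G) : ℝ) ≠ 0 := by exact_mod_cast Nat.card_pos.ne'
    field_simp
    ring
  · intro K _ K' _ hne
    refine Set.disjoint_left.mpr fun M hM hM' => ?_
    exact hne ((hM : _ = K).symm.trans hM')
  · exact fun K hK => (key K (hfin.mem_toFinset.mp hK)).1

theorem multipliable_one_sub_inv_pow (p u : ℕ) [hp : Fact p.Prime] :
    Multipliable (fun i : ℕ => 1 - ((p : ℝ) ^ (i + 1 + u))⁻¹) := by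
  have h1 : ((p : ℝ)⁻¹) < 1 := inv_lt_one_of_one_lt₀ (by exact_mod_cast hp.out.one_lt)
  have hs : Summable fun i : ℕ => -((p : ℝ) ^ (i + 1 + u))⁻¹ := by
    have := ((summable_geometric_of_lt_one (by positivity) h1).mul_left
      (((p : ℝ)⁻¹) ^ (1 + u))).neg
    refine this.congr fun i => ?_
    rw [← pow_add, ← inv_pow]
    congr 2
    omega
  simpa [sub_eq_add_neg] using Real.multipliable_one_add_of_summable hs

end RandomCokernel

theorem theorem1p1 (p : ℕ) [Fact p.Prime] (u : ℕ) (G : Type*) [AddCommGroup G] [Finite G]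
    (hG : IsPGroup p (Multiplicative G)) :
    (∀ n : ℕ, MeasurableSet (RandomCokernel.cokerEvent p u n G)) ∧
    Multipliable (fun i : ℕ => 1 - ((p : ℝ) ^ (i + 1 + u))⁻¹) ∧
    Tendsto
      (fun n : ℕ => (RandomCokernel.haarMatrix p (n + u) n).real
        (RandomCokernel.cokerEvent p u n G))
      atTop
      (𝓝 ((∏' i : ℕ, (1 - ((p : ℝ) ^ (i + 1 + u))⁻¹)) /
        ((Nat.card G : ℝ) ^ u * (Nat.card (AddAut G) : ℝ)))) := by
  obtain ⟨k, hk, ⟨_⟩⟩ := exists_padicInt_module_of_isPGroup hG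
  have hmul := RandomCokernel.multipliable_one_sub_inv_pow p u
  refine ⟨fun n => (RandomCokernel.measureReal_cokerEvent hk).1, hmul, ?_⟩
  simp_rw [(RandomCokernel.measureReal_cokerEvent hk).2]
  have h := (tendsto_card_surjective_div (R := ℤ_[p]) (G := G)).mul hmul.tendsto_prod_tprod_nat
  rw [one_mul] at h
  exact h.div_const _
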